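/- All graphs are simple. For a connected, locally finite graph with vertex set $V$ let $\Delta f(x)=\sum_{y\sim x}\big(f(x)-f(y)\big)$. For finite $W\subset V$ let $\Delta_W$ be the Laplacian on $W$ with Dirichlet boundary conditions (extend a function on $W$ by zero, apply $\Delta$, restrict to $W$), let $p^W_t(x,y)$ be the entries of the matrix $e^{-t\Delta_W}$, set to $0$ unless $x,y\in W$, and let $p_t(x,y)=\sup_W p_t^W(x,y)$ be the (minimal) heat kernel. The graph is called stochastically incomplete if $\sum_{y\in V}p_t(x,y)<1$ for some $t>0$ and some $x\in V$. Let $k:\{0,1,2,\dots\}\to\{1,2,3,\dots\}$ and $\tilde k:\{0,1,2,\dots\}\to\{0,1,2,\dots\}$. Let $T_k$ be the spherically symmetric tree with branching numbers $k(r)$, that is, the tree with a root $x_0$ such that, for every $r\ge 0$, each vertex of the sphere $S_r=\{x : d(x,x_0)=r\}$ has exactly $k(r)$ neighbors in $S_{r+1}$. Let $T_k^{\tilde k}$ be the graph obtained from $T_k$ by attaching, for every $r\ge0$, $\tilde k(r)$ new end vertices (vertices of degree $1$) to each vertex of $S_r$. Then $T_k^{\tilde k}$ is stochastically incomplete if and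 only if $$\sum_{r=0}^\infty \frac{\tilde k(r)+1}{k(r)}<\infty .$$ -/

import Mathlib

open Finset
open scoped ENNReal

namespace GraphHeat

section Laplacian

variable {V : Type*} (G : SimpleGraph V) [G.LocallyFinite]

/-- The (positive) graph Laplacian `Δ f (x) = ∑_{y ∼ x} (f x - f y)`
of a locally finite graph. -/
def laplacian (f : V → ℝ) (x : V) : ℝ :=
  ∑ y ∈ G.neighborFinset x, (f x - f y)

open Classical in
/-- The Laplacian with Dirichlet boundary conditions on a finite set `W` of vertices: functions
on `W` are extended by zero to all vertices, `Δ` is applied and the result is restricted to `W`.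
It is written here as a matrix, so that its diagonal holds the degrees taken in the whole graph
and its `(x, y)` entry is `-1` for adjacent `x, y ∈ W`. -/
noncomputable def dirichletLaplacian (W : Finset V) : Matrix W W ℝ :=
  Matrix.of fun x y => laplacian G (Pi.single (y : V) 1) x

open Classical in
/-- The heat kernel of a finite set `W` of vertices with Dirichlet boundary conditions:
the entries of `exp (-t Δ_W)`, extended by zero outside of `W × W`. -/
noncomputable def dirichletHeatKernel (W : Finset V) (t : ℝ) (x y : V) : ℝ :=
  if h : x ∈ W ∧ y ∈ W then
    (NormedSpace.exp ((-t) • dirichletLaplacian G W) : Matrix W W ℝ) ⟨x, h.1⟩ ⟨y, h.2⟩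
  else 0

/-- The (minimal) heat kernel `p_t(x, y)` of the graph, obtained by exhausting the vertex set by
finite sets. The Dirichlet heat kernels are non-negative and increase with `W`, so that the limit
along any exhaustion is the supremum over all finite sets of vertices. -/
noncomputable def heatKernel (t : ℝ) (x y : V) : ℝ≥0∞ :=
  ⨆ W : Finset V, ENNReal.ofReal (dirichletHeatKernel G W t x y)

/-- Stochastic incompleteness: `∑_y p_t(x, y) < 1` for some time `t > 0` and some vertex `x`. -/
def StochasticallyIncomplete : Prop :=
  ∃ t : ℝ, 0 < t ∧ ∃ x : V, ∑' y : V, heatKernel G t x y < 1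

end Laplacian

section Trees

variable {V : Type*}

/-- `T` is a spherically symmetric tree with root `x₀` and branching numbers `k`: it is a tree in
which every vertex of the sphere `S_r` about `x₀` has exactly `k r` neighbours in `S_{r+1}`. -/
structure IsSphericallySymmetricTree (T : SimpleGraph V) [T.LocallyFinite] (x₀ : V)
    (k : ℕ → ℕ) : Prop where
  isTree : T.IsTree
  card_outer : ∀ x : V,
    #{y ∈ T.neighborFinset x | T.dist x₀ y = T.dist x₀ x + 1} = k (T.dist x₀ x)

/-- The graph obtained from `G` by attaching `n x` end vertices to every vertex `x`. The vertices
are those of `G` together with new ones `⟨x, i⟩`, `i < n x`; the edges are those of `G`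
together with the edges from `x` to `⟨x, i⟩`. -/
def attachEnds (G : SimpleGraph V) (n : V → ℕ) : SimpleGraph (V ⊕ (Σ x : V, Fin (n x))) where
  Adj a b := match a, b with
    | Sum.inl x, Sum.inl y => G.Adj x y
    | Sum.inl x, Sum.inr e => e.1 = x
    | Sum.inr e, Sum.inl x => e.1 = x
    | Sum.inr _, Sum.inr _ => False
  symm := ⟨by
    rintro (x | e) (y | f) h
    · exact G.adj_symm h
    · exact h
    · exact h
    · exact h⟩
  loopless := ⟨by
    rintro (x | e) h
    · exact G.irrefl h
    · exact h⟩

theorem attachEnds_neighborSet_finite (G : SimpleGraph V) [G.LocallyFinite] (n : V → ℕ)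
    (a : V ⊕ (Σ x : V, Fin (n x))) : ((attachEnds G n).neighborSet a).Finite := by
  rcases a with x | e
  · refine (((G.neighborSet x).toFinite.image Sum.inl).union
      (Set.finite_range fun i : Fin (n x) => Sum.inr ⟨x, i⟩)).subset ?_
    rintro (y | ⟨z, i⟩) h
    · exact Or.inl ⟨y, h, rfl⟩
    · obtain rfl : z = x := h
      exact Or.inr ⟨i, rfl⟩
  · refine (Set.finite_singleton (Sum.inl e.1)).subset ?_
    rintro (y | f) h
    · obtain rfl : e.1 = y := h
      rfl
    · exact (h : False).elim

noncomputable instance attachEnds_locallyFinite (G : SimpleGraph V) [G.LocallyFinite]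
    (n : V → ℕ) : (attachEnds G n).LocallyFinite :=
  fun a => (attachEnds_neighborSet_finite G n a).fintype

end Trees

end GraphHeat

/-! Both directions test with one radial shape: `f r = ∏ i < r, (1 + a i)` with `a i = c * (k' i +
1) / k i`, extended to the attached ends by `f / 2`. Since an end has one neighbour, the factor
`1/2` gives `Δv = -v` there. At a tree vertex on the sphere `S_r`, outer neighbours contribute `-c
(k' + 1) f` to `Δv`, ends contribute `k' f / 2`, and the at most one inner neighbour something in
`[0, f]`. Hence `c = 2` forces `Δv ≤ -v` and `c = 1/2` forces `Δv ≥ -v`, while `f` is bounded if the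
series converges and tends to infinity otherwise.

These are the hypotheses of `stochasticallyIncomplete_of_bounded` and
`not_stochasticallyIncomplete_of_proper`, both consequences of the parabolic comparison principle
`sum_dirichletHeatKernel_mul_le` on finite sets. -/

namespace GraphHeat

/-! ### Positivity and comparison for matrix exponentials -/

section MatrixExp

variable {n : Type*} [Fintype n] [DecidableEq n]

attribute [local instance] Matrix.linftyOpNormedRing Matrix.linftyOpNormedAlgebra

theorem exp_nonneg_of_entries_nonneg {N : Matrix n n ℝ} (hN : ∀ i j, 0 ≤ N i j) (i j : n) :
    0 ≤ NormedSpace.exp N i j := by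
  have hpow : ∀ m : ℕ, ∀ i j, 0 ≤ (N ^ m) i j := by
    intro m
    induction m with
    | zero =>
      intro i j
      rw [pow_zero, Matrix.one_apply]
      split_ifs <;> norm_num
    | succ m ih =>
      intro i j
      rw [pow_succ, Matrix.mul_apply]
      exact Finset.sum_nonneg fun l _ => mul_nonneg (ih i l) (hN l j)
  have hs : HasSum (fun m : ℕ => ((m.factorial : ℝ)⁻¹) • N ^ m) (NormedSpace.exp N) :=
    NormedSpace.exp_series_hasSum_exp' (𝕂 := ℝ) N
  have hij : HasSum (fun m : ℕ => (((m.factorial : ℝ)⁻¹) • N ^ m) i j)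
      (NormedSpace.exp N i j) := Pi.hasSum.1 (Pi.hasSum.1 hs i) j
  refine hij.nonneg fun m => ?_
  rw [Matrix.smul_apply, smul_eq_mul]
  exact mul_nonneg (by positivity) (hpow m i j)

/-- For `d` above every diagonal entry, `d • 1 - A` is entrywise nonnegative, and the scalar part
splits off as a positive factor because it commutes with everything. -/
theorem exp_neg_smul_nonneg {A : Matrix n n ℝ} (hA : ∀ i j, i ≠ j → A i j ≤ 0) {t : ℝ}
    (ht : 0 ≤ t) (i j : n) : 0 ≤ NormedSpace.exp ((-t) • A) i j := by
  set d : ℝ := ∑ i, |A i i|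
  have hd : ∀ i, A i i ≤ d := fun i => (le_abs_self _).trans
    (Finset.single_le_sum (f := fun i => |A i i|) (fun _ _ => abs_nonneg _) (Finset.mem_univ i))
  have hsplit : (-t) • A = (-(t * d)) • (1 : Matrix n n ℝ) + t • (d • (1 : Matrix n n ℝ) - A) := by
    ext i j
    simp only [Matrix.add_apply, Matrix.smul_apply, Matrix.sub_apply, smul_eq_mul]
    ring
  have hscal : NormedSpace.exp ((-(t * d)) • (1 : Matrix n n ℝ)) =
      Real.exp (-(t * d)) • (1 : Matrix n n ℝ) := by
    rw [← Algebra.algebraMap_eq_smul_one, ← Algebra.algebraMap_eq_smul_one, Real.exp_eq_exp_ℝ]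
    exact (NormedSpace.algebraMap_exp_comm _).symm
  rw [hsplit, Matrix.exp_add_of_commute _ _ ((Commute.one_left _).smul_left _), hscal,
    smul_mul_assoc, one_mul, Matrix.smul_apply, smul_eq_mul]
  refine mul_nonneg (Real.exp_pos _).le (exp_nonneg_of_entries_nonneg (fun a b => ?_) i j)
  simp only [Matrix.smul_apply, Matrix.sub_apply, smul_eq_mul, Matrix.one_apply]
  refine mul_nonneg ht ?_
  split_ifs with h
  · subst h
    linarith [hd a]
  · linarith [hA a b h]

theorem hasDerivAt_exp_smul_apply (A : Matrix n n ℝ) (s : ℝ) (i j : n) :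
    HasDerivAt (fun u : ℝ => NormedSpace.exp (u • A) i j)
      ((NormedSpace.exp (s • A) * A) i j) s :=
  hasDerivAt_pi.1 (hasDerivAt_pi.1 (hasDerivAt_exp_smul_const (𝕂 := ℝ) A s) i) j

theorem hasDerivAt_exp_smul_apply' (A : Matrix n n ℝ) (s : ℝ) (i j : n) :
    HasDerivAt (fun u : ℝ => NormedSpace.exp (u • A) i j)
      ((A * NormedSpace.exp (s • A)) i j) s :=
  hasDerivAt_pi.1 (hasDerivAt_pi.1 (hasDerivAt_exp_smul_const' (𝕂 := ℝ) A s) i) j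

/-- Comparison principle: supersolutions of `φ' = -A φ` dominate the solution
with the same initial value when the off-diagonal entries of `A` are nonpositive. -/
theorem exp_neg_smul_mulVec_le {A : Matrix n n ℝ} (hA : ∀ i j, i ≠ j → A i j ≤ 0) {t : ℝ}
    (ht : 0 ≤ t) {φ φ' : ℝ → n → ℝ} (hφ : ∀ s i, HasDerivAt (fun u => φ u i) (φ' s i) s)
    (hsup : ∀ s, 0 ≤ s → s ≤ t → ∀ i, 0 ≤ φ' s i + (A.mulVec (φ s)) i) (i : n) :
    ((NormedSpace.exp ((-t) • A) : Matrix n n ℝ).mulVec (φ 0)) i ≤ φ t i := by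
  -- Duhamel: `u ↦ exp (-(t - u) A) φ(u)` has derivative `exp (-(t - u) A) (φ' + A φ) ≥ 0`, and its
  -- values at `0` and `t` are the two sides of the claim.
  set E : ℝ → Matrix n n ℝ := fun s => NormedSpace.exp ((s - t) • A) with hE
  have hEd : ∀ s j, HasDerivAt (fun u => E u i j) ((E s * A) i j) s := by
    intro s j
    have h := (hasDerivAt_exp_smul_apply A (s - t) i j).comp s ((hasDerivAt_id s).sub_const t)
    simpa [hE, Function.comp_def] using h
  have hg : ∀ s, HasDerivAt (fun u => ∑ j, E u i j * φ u j)
      (∑ j, ((E s * A) i j * φ s j + E s i j * φ' s j)) s := fun s =>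
    HasDerivAt.fun_sum fun j _ => (hEd s j).mul (hφ s j)
  have hval : ∀ s, ∑ j, ((E s * A) i j * φ s j + E s i j * φ' s j) =
      ∑ j, E s i j * (φ' s j + (A.mulVec (φ s)) j) := by
    intro s
    have h : ((E s * A).mulVec (φ s)) i = ((E s).mulVec (A.mulVec (φ s))) i := by
      rw [Matrix.mulVec_mulVec]
    simp only [Matrix.mulVec, dotProduct] at h ⊢
    simp only [mul_add, Finset.sum_add_distrib]
    rw [h, add_comm]
  have hmono : MonotoneOn (fun u => ∑ j, E u i j * φ u j) (Set.Icc 0 t) := by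
    refine monotoneOn_of_deriv_nonneg (convex_Icc 0 t)
      (fun s _ => (hg s).continuousAt.continuousWithinAt)
      (fun s _ => (hg s).differentiableAt.differentiableWithinAt) fun s hs => ?_
    rw [interior_Icc] at hs
    rw [(hg s).deriv, hval]
    refine Finset.sum_nonneg fun j _ => mul_nonneg ?_ (hsup s hs.1.le hs.2.le j)
    have h := exp_neg_smul_nonneg hA (sub_nonneg.2 hs.2.le) i j
    rwa [neg_sub] at h
  have h := hmono (Set.left_mem_Icc.2 ht) (Set.right_mem_Icc.2 ht) ht
  simpa [hE, Matrix.mulVec, dotProduct, Matrix.one_apply, NormedSpace.exp_zero] using h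

end MatrixExp

/-! ### Dirichlet heat kernels and the minimal heat kernel -/

section HeatKernel

variable {V : Type*} (G : SimpleGraph V) [G.LocallyFinite]

open Classical in
theorem dirichletLaplacian_mulVec (W : Finset V) (φ : V → ℝ) (x : W) :
    (dirichletLaplacian G W).mulVec (fun z : W => φ z) x =
      laplacian G (fun y => if y ∈ W then φ y else 0) x := by
  have hext : ∀ z : V, ∑ j : W, (Pi.single (j : V) (1 : ℝ) : V → ℝ) z * φ j =
      if z ∈ W then φ z else 0 := by
    intro z
    rw [Finset.univ_eq_attach,
      Finset.sum_attach W (fun j => (Pi.single j (1 : ℝ) : V → ℝ) z * φ j)]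
    simp [Pi.single_apply]
  simp only [Matrix.mulVec, dotProduct, dirichletLaplacian, Matrix.of_apply, laplacian,
    Finset.sum_mul]
  rw [Finset.sum_comm]
  refine Finset.sum_congr rfl fun y _ => ?_
  simp only [sub_mul, Finset.sum_sub_distrib, hext]

theorem dirichletLaplacian_offDiag_nonpos (W : Finset V) (i j : W) (hij : i ≠ j) :
    dirichletLaplacian G W i j ≤ 0 := by
  classical
  simp only [dirichletLaplacian, Matrix.of_apply, laplacian]
  refine Finset.sum_nonpos fun y _ => ?_
  rw [Pi.single_apply, Pi.single_apply, if_neg fun h => hij (Subtype.ext h)]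
  split_ifs <;> norm_num

open Classical in
theorem dirichletHeatKernel_of_mem (W : Finset V) (t : ℝ) (x y : W) :
    dirichletHeatKernel G W t x y =
      (NormedSpace.exp ((-t) • dirichletLaplacian G W) : Matrix W W ℝ) x y := by
  unfold dirichletHeatKernel
  rw [dif_pos ⟨x.2, y.2⟩]

theorem dirichletHeatKernel_of_notMem {W : Finset V} {x y : V} (h : ¬(x ∈ W ∧ y ∈ W)) (t : ℝ) :
    dirichletHeatKernel G W t x y = 0 := by
  unfold dirichletHeatKernel
  rw [dif_neg h]

theorem dirichletHeatKernel_nonneg (W : Finset V) {t : ℝ} (ht : 0 ≤ t) (x y : V) :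
    0 ≤ dirichletHeatKernel G W t x y := by
  classical
  by_cases h : x ∈ W ∧ y ∈ W
  · have := dirichletHeatKernel_of_mem G W t ⟨x, h.1⟩ ⟨y, h.2⟩
    simp only at this
    rw [this]
    exact exp_neg_smul_nonneg (dirichletLaplacian_offDiag_nonpos G W) ht _ _
  · rw [dirichletHeatKernel_of_notMem G h]

/-- Parabolic comparison principle on a finite set of vertices: a supersolution of the heat
equation on `W` that is nonnegative outside of `W` dominates the Dirichlet heat semigroup. -/
theorem sum_dirichletHeatKernel_mul_le (W : Finset V) {t : ℝ} (ht : 0 ≤ t) {φ φ' : ℝ → V → ℝ}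
    (hφ : ∀ s, ∀ x ∈ W, HasDerivAt (fun u => φ u x) (φ' s x) s)
    (hout : ∀ s, 0 ≤ s → s ≤ t → ∀ x ∉ W, 0 ≤ φ s x)
    (hsup : ∀ s, 0 ≤ s → s ≤ t → ∀ x ∈ W, 0 ≤ φ' s x + laplacian G (φ s) x)
    {x : V} (hx : x ∈ W) :
    ∑ y ∈ W, dirichletHeatKernel G W t x y * φ 0 y ≤ φ t x := by
  classical
  have key := exp_neg_smul_mulVec_le (dirichletLaplacian_offDiag_nonpos G W) ht
    (φ := fun s (z : W) => φ s z) (φ' := fun s (z : W) => φ' s z)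
    (fun s i => hφ s i i.2) (fun s hs hst i => ?_) ⟨x, hx⟩
  · refine le_trans (le_of_eq ?_) key
    rw [← Finset.sum_attach W, ← Finset.univ_eq_attach]
    simp only [Matrix.mulVec, dotProduct]
    refine Finset.sum_congr rfl fun y _ => ?_
    rw [← dirichletHeatKernel_of_mem G W t ⟨x, hx⟩ y]
  · rw [dirichletLaplacian_mulVec]
    -- Cutting `φ` off to zero outside `W`, where it is nonnegative, can only increase its Laplacian
    -- on `W`.
    refine (hsup s hs hst i i.2).trans (add_le_add le_rfl ?_)
    refine Finset.sum_le_sum fun y _ => ?_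
    simp only [if_pos i.2]
    split_ifs with hy
    · exact le_rfl
    · linarith [hout s hs hst y hy]

open Classical in
theorem dirichletHeatKernel_zero (W : Finset V) {x : V} (hx : x ∈ W) (y : V) :
    dirichletHeatKernel G W 0 x y = if x = y then 1 else 0 := by
  by_cases hy : y ∈ W
  · have := dirichletHeatKernel_of_mem G W 0 ⟨x, hx⟩ ⟨y, hy⟩
    simp only at this
    rw [this, neg_zero, zero_smul, NormedSpace.exp_zero, Matrix.one_apply]
    simp only [Subtype.mk.injEq]
  · rw [dirichletHeatKernel_of_notMem G (fun h => hy h.2), if_neg]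
    rintro rfl
    exact hy hx

theorem hasDerivAt_dirichletHeatKernel (W : Finset V) {x y : V} (hx : x ∈ W) (hy : y ∈ W) (s : ℝ) :
    HasDerivAt (fun u => dirichletHeatKernel G W u x y)
      (-laplacian G (fun z => dirichletHeatKernel G W s z y) x) s := by
  classical
  have h := (hasDerivAt_exp_smul_apply' (dirichletLaplacian G W) (-s) ⟨x, hx⟩ ⟨y, hy⟩).comp s
    (hasDerivAt_neg s)
  have hfun : (fun u => dirichletHeatKernel G W u x y) =
      (fun u : ℝ => (NormedSpace.exp (u • dirichletLaplacian G W) : Matrix W W ℝ)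
        ⟨x, hx⟩ ⟨y, hy⟩) ∘ Neg.neg := by
    funext u
    exact dirichletHeatKernel_of_mem G W u ⟨x, hx⟩ ⟨y, hy⟩
  rw [hfun]
  refine h.congr_deriv ?_
  rw [mul_neg_one, neg_inj, Matrix.mul_apply]
  have hm := dirichletLaplacian_mulVec G W (fun z => dirichletHeatKernel G W s z y) ⟨x, hx⟩
  have hext : (fun z => if z ∈ W then dirichletHeatKernel G W s z y else 0) =
      fun z => dirichletHeatKernel G W s z y := by
    funext z
    split_ifs with hz
    · rfl
    · rw [dirichletHeatKernel_of_notMem G fun h => hz h.1]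
  rw [hext] at hm
  simp only at hm
  rw [← hm]
  simp only [Matrix.mulVec, dotProduct]
  refine Finset.sum_congr rfl fun z _ => ?_
  rw [← dirichletHeatKernel_of_mem G W s z ⟨y, hy⟩]

/-- On the smaller set, the kernel of `W'` with `y` fixed solves the heat equation, starts as the
delta at `y`, and is nonnegative outside; comparison applies. -/
theorem dirichletHeatKernel_mono {t : ℝ} (ht : 0 ≤ t) (x y : V) :
    Monotone fun W : Finset V => dirichletHeatKernel G W t x y := by
  classical
  intro W W' hW
  by_cases h : x ∈ W ∧ y ∈ W
  · have key := sum_dirichletHeatKernel_mul_le G W ht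
      (φ := fun s z => dirichletHeatKernel G W' s z y)
      (φ' := fun s z => -laplacian G (fun z => dirichletHeatKernel G W' s z y) z)
      (fun s z hz => hasDerivAt_dirichletHeatKernel G W' (hW hz) (hW h.2) s)
      (fun s hs _ z _ => dirichletHeatKernel_nonneg G W' hs z y)
      (fun s _ _ z _ => (neg_add_cancel _).ge) h.1
    refine le_trans (le_of_eq ?_) key
    rw [Finset.sum_eq_single_of_mem y h.2, dirichletHeatKernel_zero G W' (hW h.2),
      if_pos rfl, mul_one]
    intro z hz hzy
    rw [dirichletHeatKernel_zero G W' (hW hz), if_neg hzy, mul_zero]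
  · simp only
    rw [dirichletHeatKernel_of_notMem G h]
    exact dirichletHeatKernel_nonneg G W' ht x y

theorem tsum_heatKernel_le {t : ℝ} (ht : 0 ≤ t) (x : V) {C : ℝ}
    (hC : ∀ W : Finset V, x ∈ W → ∑ y ∈ W, dirichletHeatKernel G W t x y ≤ C) :
    ∑' y, heatKernel G t x y ≤ ENNReal.ofReal C := by
  classical
  refine ENNReal.summable.tsum_le_of_sum_le fun F => ?_
  unfold heatKernel
  -- Monotonicity in `W` lets the supremum pass through the finite sum.
  rw [ENNReal.finsetSum_iSup_of_monotone fun y W W' hW =>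
    ENNReal.ofReal_le_ofReal (dirichletHeatKernel_mono G ht x y hW)]
  refine iSup_le fun W => ?_
  set W' := insert x (W ∪ F)
  have hWW' : W ⊆ W' := subset_union_left.trans (subset_insert _ _)
  have hFW' : F ⊆ W' := subset_union_right.trans (subset_insert _ _)
  calc ∑ y ∈ F, ENNReal.ofReal (dirichletHeatKernel G W t x y)
      ≤ ∑ y ∈ F, ENNReal.ofReal (dirichletHeatKernel G W' t x y) :=
        Finset.sum_le_sum fun y _ =>
          ENNReal.ofReal_le_ofReal (dirichletHeatKernel_mono G ht x y hWW')
    _ ≤ ∑ y ∈ W', ENNReal.ofReal (dirichletHeatKernel G W' t x y) :=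
        Finset.sum_le_sum_of_subset hFW'
    _ = ENNReal.ofReal (∑ y ∈ W', dirichletHeatKernel G W' t x y) :=
        (ENNReal.ofReal_sum_of_nonneg fun y _ => dirichletHeatKernel_nonneg G W' ht x y).symm
    _ ≤ ENNReal.ofReal C := ENNReal.ofReal_le_ofReal (hC W' (mem_insert_self _ _))

theorem ofReal_sum_dirichletHeatKernel_le {t : ℝ} (ht : 0 ≤ t) (x : V) (W : Finset V) :
    ENNReal.ofReal (∑ y ∈ W, dirichletHeatKernel G W t x y) ≤ ∑' y, heatKernel G t x y := by
  rw [ENNReal.ofReal_sum_of_nonneg fun y _ => dirichletHeatKernel_nonneg G W ht x y]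
  exact (Finset.sum_le_sum fun y _ => le_iSup
    (fun W => ENNReal.ofReal (dirichletHeatKernel G W t x y)) W).trans (ENNReal.sum_le_tsum W)

/-! ### Criteria for stochastic incompleteness and completeness -/

theorem laplacian_sub_const_mul (v : V → ℝ) (a b : ℝ) (x : V) :
    laplacian G (fun z => a - b * v z) x = -(b * laplacian G v x) := by
  unfold laplacian
  rw [Finset.mul_sum, ← Finset.sum_neg_distrib]
  exact Finset.sum_congr rfl fun y _ => by ring

/-- A graph with a bounded positive `1`-subharmonic function is stochastically incomplete. -/
theorem stochasticallyIncomplete_of_bounded {v : V → ℝ} {M : ℝ} [Nonempty V]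
    (hpos : ∀ x, 0 < v x) (hM : ∀ x, v x ≤ M) (hv : ∀ x, laplacian G v x ≤ -v x) :
    StochasticallyIncomplete G := by
  obtain ⟨x⟩ := ‹Nonempty V›
  have hM0 : 0 < M := (hpos x).trans_le (hM x)
  obtain ⟨t, ht, hexp⟩ : ∃ t : ℝ, 0 < t ∧ Real.exp (-t) * M < v x := by
    have h : Filter.Tendsto (fun t : ℝ => Real.exp (-t) * M) Filter.atTop (nhds (0 * M)) :=
      (Real.tendsto_exp_neg_atTop_nhds_zero).mul_const M
    rw [zero_mul] at h
    exact ((Filter.eventually_gt_atTop 0).and (h.eventually_lt_const (hpos x))).exists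
  refine ⟨t, ht, x, ?_⟩
  refine (tsum_heatKernel_le G ht.le x
    (C := (M - v x) / (M - Real.exp (-t) * M)) fun W hx => ?_).trans_lt ?_
  -- The supersolution `M - exp (s - t) * v` is at least `M - exp (-t) * M` at time `0` and equals
  -- `M - v` at time `t`. The quotient `C` is below `1` by the choice of `t`.
  · have key := sum_dirichletHeatKernel_mul_le G W ht.le
      (φ := fun s z => M - Real.exp (s - t) * v z)
      (φ' := fun s z => -(Real.exp (s - t) * v z)) (fun s z _ => ?_) (fun s _ hst z _ => ?_)
      (fun s _ _ z _ => ?_) hx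
    · rw [le_div_iff₀ (by linarith [hM x]), Finset.sum_mul]
      refine (Finset.sum_le_sum fun y _ => ?_).trans (key.trans_eq ?_)
      · refine mul_le_mul_of_nonneg_left ?_ (dirichletHeatKernel_nonneg G W ht.le x y)
        rw [zero_sub]
        have := mul_le_mul_of_nonneg_left (hM y) (Real.exp_pos (-t)).le
        linarith
      · simp
    · have h := ((((hasDerivAt_id s).sub_const t).exp).mul_const (v z)).const_sub M
      simpa using h
    · have h1 : Real.exp (s - t) ≤ 1 := Real.exp_le_one_iff.2 (by linarith)
      have := mul_le_mul h1 (hM z) (hpos z).le zero_le_one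
      linarith
    · rw [laplacian_sub_const_mul]
      have := mul_le_mul_of_nonneg_left (hv z) (Real.exp_pos (s - t)).le
      linarith
  · rw [ENNReal.ofReal_lt_one, div_lt_one (by linarith [hM x])]
    linarith

/-- A graph with a nonnegative `1`-superharmonic function whose sublevel sets are finite is
stochastically complete. -/
theorem not_stochasticallyIncomplete_of_proper {v : V → ℝ} (hnonneg : ∀ x, 0 ≤ v x)
    (hfin : ∀ C : ℝ, {x | v x < C}.Finite) (hv : ∀ x, -v x ≤ laplacian G v x) :
    ¬StochasticallyIncomplete G := by
  rintro ⟨t, ht, x, hlt⟩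
  refine hlt.not_ge (le_of_forall_lt fun c hc => ?_)
  have hlim : Filter.Tendsto (fun C : ℝ => 1 - v x * Real.exp t / C) Filter.atTop (nhds 1) := by
    simpa using (Filter.Tendsto.const_div_atTop Filter.tendsto_id (v x * Real.exp t)).const_sub 1
  have hlim' := ENNReal.tendsto_ofReal hlim
  rw [ENNReal.ofReal_one] at hlim'
  obtain ⟨C, hCc, hCx, hC0⟩ := ((hlim'.eventually_const_lt hc).and
    ((Filter.eventually_gt_atTop (v x)).and (Filter.eventually_gt_atTop 0))).exists
  refine hCc.trans_le (le_trans (ENNReal.ofReal_le_ofReal ?_)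
    (ofReal_sum_dirichletHeatKernel_le G ht.le x (hfin C).toFinset))
  have hC' : 0 < 1 / C := by positivity
  -- The supersolution is `exp s * v / C - 1`, nonnegative off `{v < C}`. It yields kernel mass at
  -- least `1 - exp t * v x / C`, which tends to `1` as `C` grows. The double negation matches
  -- `laplacian_sub_const_mul`.
  have key := sum_dirichletHeatKernel_mul_le G (hfin C).toFinset ht.le
    (φ := fun s z => -1 - -(1 / C * Real.exp s) * v z)
    (φ' := fun s z => 1 / C * Real.exp s * v z) (fun s z _ => ?_) (fun s hs _ z hz => ?_)
    (fun s _ _ z _ => ?_) (x := x) (by simpa using hCx)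
  · have hlow : -∑ y ∈ (hfin C).toFinset, dirichletHeatKernel G (hfin C).toFinset t x y ≤
        ∑ y ∈ (hfin C).toFinset, dirichletHeatKernel G (hfin C).toFinset t x y *
          (-1 - -(1 / C * Real.exp 0) * v y) := by
      rw [← Finset.sum_neg_distrib]
      refine Finset.sum_le_sum fun y _ => ?_
      have h1 := dirichletHeatKernel_nonneg G (hfin C).toFinset ht.le x y
      have h2 : 0 ≤ 1 / C * Real.exp 0 * v y := by have := hnonneg y; positivity
      nlinarith [mul_nonneg h1 h2]
    have heq : v x * Real.exp t / C = 1 / C * Real.exp t * v x := by ring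
    rw [heq]
    linarith [hlow.trans key]
  · have h := ((((Real.hasDerivAt_exp s).const_mul (1 / C)).neg).mul_const (v z)).const_sub (-1)
    simpa using h
  · have hz' : C ≤ v z := by simpa using hz
    have h1 : 1 ≤ 1 / C * v z := by rw [one_div_mul_eq_div, one_le_div hC0]; exact hz'
    have h2 := mul_le_mul (Real.one_le_exp hs) h1 zero_le_one (Real.exp_pos s).le
    linarith
  · rw [laplacian_sub_const_mul]
    have := mul_le_mul_of_nonneg_left (hv z) (mul_pos hC' (Real.exp_pos s)).le
    linarith

end HeatKernel

/-! ### Laplacians of radial functions on trees with ends -/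

section Tree

variable {V : Type*}

theorem laplacian_attachEnds_inl (G : SimpleGraph V) [G.LocallyFinite] (n : V → ℕ)
    (g : V ⊕ (Σ x : V, Fin (n x)) → ℝ) (x : V) :
    laplacian (attachEnds G n) g (Sum.inl x) =
      laplacian G (fun y => g (Sum.inl y)) x +
        ∑ i : Fin (n x), (g (Sum.inl x) - g (Sum.inr ⟨x, i⟩)) := by
  have h : (attachEnds G n).neighborFinset (Sum.inl x) =
      (G.neighborFinset x).disjSum
        (Finset.univ.map (Function.Embedding.sigmaMk (β := fun x : V => Fin (n x)) x)) := by
    ext (y | ⟨z, i⟩)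
    · rw [SimpleGraph.mem_neighborFinset, Finset.inl_mem_disjSum, SimpleGraph.mem_neighborFinset]
      rfl
    · rw [SimpleGraph.mem_neighborFinset, Finset.inr_mem_disjSum, Finset.mem_map]
      constructor
      · intro hz
        obtain rfl : z = x := hz
        exact ⟨i, Finset.mem_univ _, rfl⟩
      · rintro ⟨j, -, hj⟩
        exact (congrArg Sigma.fst hj).symm
  unfold laplacian
  rw [h, Finset.sum_disjSum, Finset.sum_map]
  rfl

theorem laplacian_attachEnds_inr (G : SimpleGraph V) [G.LocallyFinite] (n : V → ℕ)
    (g : V ⊕ (Σ x : V, Fin (n x)) → ℝ) (e : Σ x : V, Fin (n x)) :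
    laplacian (attachEnds G n) g (Sum.inr e) = g (Sum.inr e) - g (Sum.inl e.1) := by
  have h : (attachEnds G n).neighborFinset (Sum.inr e) = {Sum.inl e.1} := by
    ext (y | f)
    · rw [SimpleGraph.mem_neighborFinset, Finset.mem_singleton, Sum.inl.injEq, eq_comm (a := y)]
      rfl
    · rw [SimpleGraph.mem_neighborFinset, Finset.mem_singleton]
      exact iff_of_false id Sum.inr_ne_inl
  unfold laplacian
  rw [h, Finset.sum_singleton]

/-- A geodesic from `u` to a closer neighbour of `x` extends to a path ending at `x`; uniqueness of
paths in a tree identifies the last steps. -/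
theorem _root_.SimpleGraph.IsTree.eq_of_adj_of_dist_lt {T : SimpleGraph V} (hT : T.IsTree)
    {u x y z : V} (hy : T.Adj x y) (hz : T.Adj x z) (hyd : T.dist u y < T.dist u x)
    (hzd : T.dist u z < T.dist u x) : y = z := by
  have key : ∀ w, T.Adj x w → T.dist u w < T.dist u x →
      ∃ p : T.Walk u w, ∃ h : T.Adj w x, (p.concat h).IsPath := by
    intro w hw hwd
    obtain ⟨p, -, hp⟩ := hT.connected.exists_path_of_dist u w
    refine ⟨p, hw.symm, SimpleGraph.Walk.isPath_of_length_eq_dist _ ?_⟩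
    have := hT.dist_eq_dist_add_one_of_adj u hw
    rw [SimpleGraph.Walk.length_concat]
    omega
  obtain ⟨p, hp, hpp⟩ := key y hy hyd
  obtain ⟨q, hq, hqp⟩ := key z hz hzd
  exact (SimpleGraph.Walk.concat_inj
    ((hT.existsUnique_path u x).unique hpp hqp)).1

theorem _root_.SimpleGraph.Connected.finite_setOf_dist_lt {G : SimpleGraph V} [G.LocallyFinite]
    (hG : G.Connected) (u : V) (R : ℕ) : {x | G.dist u x < R}.Finite := by
  induction R with
  | zero => simp
  | succ R ih =>
    refine ((ih.biUnion fun x _ => (G.neighborSet x).toFinite).union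
      (Set.finite_singleton u)).subset fun x hx => ?_
    by_cases hxu : u = x
    · exact Or.inr hxu.symm
    · obtain ⟨p, hp⟩ := hG.exists_walk_length_eq_dist x u
      cases p with
      | nil => exact (hxu rfl).elim
      | @cons _ y _ h p =>
        refine Or.inl (Set.mem_biUnion (x := y) ?_ h.symm)
        have h1 : G.dist u y ≤ p.length := by
          rw [SimpleGraph.dist_comm]
          exact SimpleGraph.dist_le p
        rw [SimpleGraph.Walk.length_cons, SimpleGraph.dist_comm] at hp
        have h2 : G.dist u x < R + 1 := hx
        exact show G.dist u y < R by omega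

variable {T : SimpleGraph V} [T.LocallyFinite] {x₀ : V} {k : ℕ → ℕ}

theorem IsSphericallySymmetricTree.sum_outer (hT : IsSphericallySymmetricTree T x₀ k)
    (f : ℕ → ℝ) (x : V) :
    ∑ y ∈ T.neighborFinset x with T.dist x₀ y = T.dist x₀ x + 1,
      (f (T.dist x₀ x) - f (T.dist x₀ y)) =
      -(k (T.dist x₀ x) * (f (T.dist x₀ x + 1) - f (T.dist x₀ x))) := by
  rw [← hT.card_outer x, Finset.sum_congr rfl fun y hy => by rw [(Finset.mem_filter.1 hy).2],
    Finset.sum_const, nsmul_eq_mul]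
  ring

theorem IsSphericallySymmetricTree.dist_lt_of_inner (hT : IsSphericallySymmetricTree T x₀ k)
    {x y : V} (hy : y ∈ {y ∈ T.neighborFinset x | ¬T.dist x₀ y = T.dist x₀ x + 1}) :
    T.Adj x y ∧ T.dist x₀ y < T.dist x₀ x := by
  rw [Finset.mem_filter, SimpleGraph.mem_neighborFinset] at hy
  have := hT.isTree.dist_eq_dist_add_one_of_adj x₀ hy.1
  exact ⟨hy.1, by omega⟩

theorem IsSphericallySymmetricTree.le_laplacian (hT : IsSphericallySymmetricTree T x₀ k)
    {f : ℕ → ℝ} (hf : Monotone f) (x : V) :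
    -(k (T.dist x₀ x) * (f (T.dist x₀ x + 1) - f (T.dist x₀ x))) ≤
      laplacian T (fun y => f (T.dist x₀ y)) x := by
  unfold laplacian
  rw [← Finset.sum_filter_add_sum_filter_not _ (fun y => T.dist x₀ y = T.dist x₀ x + 1),
    hT.sum_outer f]
  refine le_add_of_nonneg_right (Finset.sum_nonneg fun y hy => ?_)
  exact sub_nonneg.2 (hf (hT.dist_lt_of_inner hy).2.le)

/-- Adjacent vertices of a tree are never equidistant from the root, so a non-outer neighbour is the
unique parent, whose term is at most `f` at `x`. -/
theorem IsSphericallySymmetricTree.laplacian_le (hT : IsSphericallySymmetricTree T x₀ k)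
    {f : ℕ → ℝ} (hf0 : ∀ r, 0 ≤ f r) (x : V) :
    laplacian T (fun y => f (T.dist x₀ y)) x ≤
      -(k (T.dist x₀ x) * (f (T.dist x₀ x + 1) - f (T.dist x₀ x))) + f (T.dist x₀ x) := by
  unfold laplacian
  rw [← Finset.sum_filter_add_sum_filter_not _ (fun y => T.dist x₀ y = T.dist x₀ x + 1),
    hT.sum_outer f]
  refine add_le_add le_rfl ?_
  have hcard : #{y ∈ T.neighborFinset x | ¬T.dist x₀ y = T.dist x₀ x + 1} ≤ 1 := by
    refine Finset.card_le_one.2 fun y hy z hz => ?_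
    have h1 := hT.dist_lt_of_inner hy
    have h2 := hT.dist_lt_of_inner hz
    exact hT.isTree.eq_of_adj_of_dist_lt h1.1 h2.1 h1.2 h2.2
  refine (Finset.sum_le_card_nsmul _ _ (f (T.dist x₀ x)) fun y _ => by
    linarith [hf0 (T.dist x₀ y)]).trans ?_
  rw [nsmul_eq_mul]
  exact mul_le_of_le_one_left (hf0 _) (by exact_mod_cast hcard)

/-- The radial function `f` on the tree, with half the value of the base point on the ends. -/
noncomputable def radialPotential (T : SimpleGraph V) (x₀ : V) (n : V → ℕ) (f : ℕ → ℝ) :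
    V ⊕ (Σ x : V, Fin (n x)) → ℝ :=
  Sum.elim (fun x => f (T.dist x₀ x)) fun e => f (T.dist x₀ e.1) / 2

theorem laplacian_radialPotential_inl (n : V → ℕ) (f : ℕ → ℝ) (x : V) :
    laplacian (attachEnds T n) (radialPotential T x₀ n f) (Sum.inl x) =
      laplacian T (fun y => f (T.dist x₀ y)) x + n x * (f (T.dist x₀ x) / 2) := by
  rw [laplacian_attachEnds_inl]
  simp only [radialPotential, Sum.elim_inl, Sum.elim_inr, sub_half, Finset.sum_const,
    Finset.card_univ, Fintype.card_fin, nsmul_eq_mul]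

theorem laplacian_radialPotential_inr (n : V → ℕ) (f : ℕ → ℝ) (e : Σ x : V, Fin (n x)) :
    laplacian (attachEnds T n) (radialPotential T x₀ n f) (Sum.inr e) =
      -radialPotential T x₀ n f (Sum.inr e) := by
  rw [laplacian_attachEnds_inr]
  simp only [radialPotential, Sum.elim_inl, Sum.elim_inr]
  ring

/-! ### The product functions and the two implications -/

theorem monotone_prod_one_add {a : ℕ → ℝ} (ha : ∀ i, 0 ≤ a i) :
    Monotone fun r => ∏ i ∈ range r, (1 + a i) := by
  refine monotone_nat_of_le_succ fun r => ?_
  rw [Finset.prod_range_succ]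
  exact le_mul_of_one_le_right
    (Finset.prod_nonneg fun i _ => by linarith [ha i]) (by linarith [ha r])

theorem sum_le_prod_one_add {a : ℕ → ℝ} (ha : ∀ i, 0 ≤ a i) (r : ℕ) :
    ∑ i ∈ range r, a i ≤ ∏ i ∈ range r, (1 + a i) := by
  have h : ∀ r, 1 + ∑ i ∈ range r, a i ≤ ∏ i ∈ range r, (1 + a i) := by
    intro r
    induction r with
    | zero => simp
    | succ r ih =>
      rw [Finset.sum_range_succ, Finset.prod_range_succ]
      have hs : 0 ≤ ∑ i ∈ range r, a i := Finset.sum_nonneg fun i _ => ha i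
      nlinarith [mul_le_mul_of_nonneg_right ih (ha r), mul_nonneg hs (ha r)]
  linarith [h r]

theorem stochasticallyIncomplete_attachEnds_of_summable (hk : ∀ r, 0 < k r)
    (hT : IsSphericallySymmetricTree T x₀ k) (k' : ℕ → ℕ)
    (hs : Summable fun r : ℕ => ((k' r : ℝ) + 1) / (k r : ℝ)) :
    StochasticallyIncomplete (attachEnds T fun x => k' (T.dist x₀ x)) := by
  -- With factor `2` the outward term `2 (k' + 1) f` covers the parent's `f`, the ends' `k' f / 2`,
  -- and the required `f`.
  set a : ℕ → ℝ := fun r => 2 * (((k' r : ℝ) + 1) / (k r : ℝ)) with ha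
  have ha0 : ∀ r, 0 ≤ a r := fun r => by simp only [ha]; positivity
  set f : ℕ → ℝ := fun r => ∏ i ∈ range r, (1 + a i) with hf
  have hfpos : ∀ r, 0 < f r := fun r => Finset.prod_pos fun i _ => by linarith [ha0 i]
  have hsa : Summable a := hs.mul_left 2
  have hfM : ∀ r, f r ≤ Real.exp (∑' i, a i) := fun r =>
    (Real.prod_one_add_le_exp_sum _ ha0).trans
      (Real.exp_le_exp.2 (hsa.sum_le_tsum _ fun i _ => ha0 i))
  have : Nonempty (V ⊕ (Σ x : V, Fin (k' (T.dist x₀ x)))) := ⟨Sum.inl x₀⟩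
  refine stochasticallyIncomplete_of_bounded _
    (v := radialPotential T x₀ (fun x => k' (T.dist x₀ x)) f) (M := Real.exp (∑' i, a i)) ?_ ?_ ?_
  · rintro (x | e)
    · exact hfpos _
    · exact half_pos (hfpos _)
  · rintro (x | e)
    · exact hfM _
    · exact (half_le_self (hfpos _).le).trans (hfM _)
  · rintro (x | e)
    · rw [laplacian_radialPotential_inl]
      have h1 := hT.laplacian_le (fun r => (hfpos r).le) x
      simp only [radialPotential, Sum.elim_inl]
      set r := T.dist x₀ x
      have hkr : (0 : ℝ) < k r := by exact_mod_cast hk r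
      have h2 : (k r : ℝ) * (f (r + 1) - f r) = 2 * (k' r + 1) * f r := by
        have h3 : f (r + 1) = f r * (1 + a r) := Finset.prod_range_succ _ _
        rw [h3]
        simp only [ha]
        field_simp
        ring
      rw [h2] at h1
      have h4 : 0 ≤ (k' r : ℝ) * f r := mul_nonneg (Nat.cast_nonneg _) (hfpos r).le
      linarith
    · exact (laplacian_radialPotential_inr _ f e).le

theorem not_stochasticallyIncomplete_attachEnds_of_not_summable (hk : ∀ r, 0 < k r)
    (hT : IsSphericallySymmetricTree T x₀ k) (k' : ℕ → ℕ)
    (hs : ¬Summable fun r : ℕ => ((k' r : ℝ) + 1) / (k r : ℝ)) :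
    ¬StochasticallyIncomplete (attachEnds T fun x => k' (T.dist x₀ x)) := by
  -- With factor `1/2` the ends' `k' f / 2` cancels against the outward term, leaving `-f / 2 ≥ -f`.
  set a : ℕ → ℝ := fun r => 1 / 2 * (((k' r : ℝ) + 1) / (k r : ℝ)) with ha
  have ha0 : ∀ r, 0 ≤ a r := fun r => by simp only [ha]; positivity
  set f : ℕ → ℝ := fun r => ∏ i ∈ range r, (1 + a i) with hf
  have hfpos : ∀ r, 0 < f r := fun r => Finset.prod_pos fun i _ => by linarith [ha0 i]
  have hfmono : Monotone f := monotone_prod_one_add ha0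
  have hftop : Filter.Tendsto f Filter.atTop Filter.atTop := by
    refine Filter.tendsto_atTop_mono (sum_le_prod_one_add ha0)
      ((not_summable_iff_tendsto_nat_atTop_of_nonneg ha0).1 fun h => hs ?_)
    exact (summable_mul_left_iff (by norm_num)).1 h
  refine not_stochasticallyIncomplete_of_proper _
    (v := radialPotential T x₀ (fun x => k' (T.dist x₀ x)) f) ?_ ?_ ?_
  · rintro (x | e)
    · exact (hfpos _).le
    · exact (half_pos (hfpos _)).le
  · intro C
    -- The threshold `2 * C` serves the ends, where the value is halved.
    obtain ⟨R, hR⟩ := ((hftop.eventually_ge_atTop (2 * C)).and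
      (hftop.eventually_ge_atTop C)).exists_forall_of_atTop
    have hball := hT.isTree.connected.finite_setOf_dist_lt x₀ R
    have hends : ∀ x, (Set.range fun i : Fin (k' (T.dist x₀ x)) =>
        (Sum.inr ⟨x, i⟩ : V ⊕ (Σ x : V, Fin (k' (T.dist x₀ x))))).Finite :=
      fun x => Set.finite_range _
    refine ((hball.image Sum.inl).union (hball.biUnion fun x _ => hends x)).subset ?_
    rintro (x | ⟨x, i⟩) hx
    · refine Or.inl ⟨x, ?_, rfl⟩
      by_contra h
      exact absurd (hR _ (not_lt.1 h)).2 (not_le.2 hx)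
    · refine Or.inr (Set.mem_biUnion (x := x) ?_ ⟨i, rfl⟩)
      by_contra h
      have h1 := (hR _ (not_lt.1 h)).1
      have h2 : f (T.dist x₀ x) / 2 < C := hx
      linarith
  · rintro (x | e)
    · rw [laplacian_radialPotential_inl]
      have h1 := hT.le_laplacian hfmono x
      simp only [radialPotential, Sum.elim_inl]
      set r := T.dist x₀ x
      have hkr : (0 : ℝ) < k r := by exact_mod_cast hk r
      have h2 : (k r : ℝ) * (f (r + 1) - f r) = 1 / 2 * (k' r + 1) * f r := by
        have h3 : f (r + 1) = f r * (1 + a r) := Finset.prod_range_succ _ _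
        rw [h3]
        simp only [ha]
        field_simp
        ring
      rw [h2] at h1
      have h4 := (hfpos r).le
      linarith
    · exact (laplacian_radialPotential_inr _ f e).ge

end Tree

end GraphHeat

theorem theorem4p2 {V : Type*} (T : SimpleGraph V) [T.LocallyFinite] (x₀ : V)
    (k k' : ℕ → ℕ) (hk : ∀ r, 0 < k r)
    (hT : GraphHeat.IsSphericallySymmetricTree T x₀ k) :
    GraphHeat.StochasticallyIncomplete
        (GraphHeat.attachEnds T (fun x => k' (T.dist x₀ x))) ↔
      Summable (fun r : ℕ => ((k' r : ℝ) + 1) / (k r : ℝ)) := by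
  refine ⟨fun h => ?_,
    GraphHeat.stochasticallyIncomplete_attachEnds_of_summable hk hT k'⟩
  by_contra hs
  exact GraphHeat.not_stochasticallyIncomplete_attachEnds_of_not_summable hk hT k' hs h
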